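/- Let $R$ be a commutative Noetherian local ring of Krull dimension two which is Gorenstein, i.e. $R$ has finite injective dimension as a module over itself. A finitely generated $R$-module is maximal Cohen-Macaulay (MCM) if its depth is at least $\dim R$ (the zero module has depth $\infty$). For MCM modules $M,N$ let $\underline{\mathrm{Hom}}_R(M,N)$ be the quotient of $\mathrm{Hom}_R(M,N)$ by the submodule of all maps which factor through a finitely generated projective module; with these morphisms the MCM modules form the stable category $\underline{\mathrm{MCM}}(R)$. Put $\underline{\mathrm{ann}}_R(M)=\mathrm{ann}_R\,\underline{\mathrm{End}}_R(M)$. Let $\mathfrak{CM}(R)$ be the set of isomorphism classes of objects of $\underline{\mathrm{MCM}}(R)$, preordered by $N\le M$ if and only if $\underline{\mathrm{ann}}_R(N)\subseteq\underline{\mathrm{ann}}_R(M)$, with the Alexandrov topology in which a subset $U$ is closed if and only if $U=\bigcup_{a\in U}\{x : x\le a\}$. A (not necessarily commutative) $R$-algebra $\Lambda$ is called an $R$-order if it is finitely generated and MCM as an $R$-module; an $R$-order is called nonsingular if the $\Lambda$-module $\mathrm{Hom}_R(\Lambda,R)$ is projective and $\Lambda$ has finite global dimension. **Theorem.** If there is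 a nonsingular $R$-order $\Lambda$ whose structure map $R\to\Lambda$ is a split monomorphism of $R$-modules, then $\mathfrak{CM}(R)$ is compact (every open cover has a finite subcover). -/

import Mathlib

open CategoryTheory

universe w v u

namespace CMSpace

/-! ### Alexandrov spaces of linear categories -/

section Alexandrov

/-- The annihilator `ann_R X = ann_R End(X)` of an object of an `R`-linear category. -/
def objAnn (R : Type w) [CommRing R] {C : Type u} [Category.{v} C] [Preadditive C] [Linear R C]
    (X : C) : Ideal R :=
  Module.annihilator R (X ⟶ X)

theorem objAnn_le_of_iso (R : Type w) [CommRing R] {C : Type u} [Category.{v} C] [Preadditive C]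
    [Linear R C] {X Y : C} (e : X ≅ Y) : objAnn R X ≤ objAnn R Y := by
  intro r hr
  rw [objAnn, Module.mem_annihilator] at hr ⊢
  intro f
  have h : r • (e.hom ≫ f ≫ e.inv) = 0 := hr _
  have h2 : r • f = e.inv ≫ (r • (e.hom ≫ f ≫ e.inv)) ≫ e.hom := by simp
  rw [h2, h]
  simp

theorem objAnn_eq_of_iso (R : Type w) [CommRing R] {C : Type u} [Category.{v} C] [Preadditive C]
    [Linear R C] {X Y : C} (e : X ≅ Y) : objAnn R X = objAnn R Y :=
  le_antisymm (objAnn_le_of_iso R e) (objAnn_le_of_iso R e.symm)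

/-- The set of isomorphism classes of objects of an `R`-linear category; it carries the preorder
and the topology defined below. -/
def AlexandrovSpace (R : Type w) [CommRing R] (C : Type u) [Category.{v} C] [Preadditive C]
    [Linear R C] : Type u :=
  Quotient (isIsomorphicSetoid C)

/-- The annihilator of an isomorphism class of objects. -/
def AlexandrovSpace.ann {R : Type w} [CommRing R] {C : Type u} [Category.{v} C] [Preadditive C]
    [Linear R C] (x : AlexandrovSpace R C) : Ideal R :=
  Quotient.lift (s := isIsomorphicSetoid C) (fun X : C => objAnn R X)
    (fun _ _ h => h.elim fun e => objAnn_eq_of_iso R e) x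

/-- The preorder: `N ≤ M` if and only if `ann_R N ⊆ ann_R M`. -/
instance AlexandrovSpace.instPreorder (R : Type w) [CommRing R] (C : Type u) [Category.{v} C]
    [Preadditive C] [Linear R C] : Preorder (AlexandrovSpace R C) :=
  Preorder.lift AlexandrovSpace.ann

/-- The Alexandrov topology of the preorder: the open sets are the upper sets, hence
the closed sets are the lower sets (see `AlexandrovSpace.isClosed_iff`). -/
instance AlexandrovSpace.instTopologicalSpace (R : Type w) [CommRing R] (C : Type u)
    [Category.{v} C] [Preadditive C] [Linear R C] : TopologicalSpace (AlexandrovSpace R C) :=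
  Topology.upperSet (AlexandrovSpace R C)

/-- A set `U` is closed if and only if it equals the union of the sets
`cl(a) = {x | x ≤ a}` for `a ∈ U`. -/
theorem AlexandrovSpace.isClosed_iff (R : Type w) [CommRing R] (C : Type u)
    [Category.{v} C] [Preadditive C] [Linear R C] (U : Set (AlexandrovSpace R C)) :
    IsClosed U ↔ (⋃ a ∈ U, {x | x ≤ a}) = U := by
  have : Topology.IsUpperSet (AlexandrovSpace R C) := ⟨rfl⟩
  rw [Topology.IsUpperSet.isClosed_iff_isLower]
  constructor
  · intro h
    ext x
    simp only [Set.mem_iUnion, Set.mem_ofPred_eq, exists_prop]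
    exact ⟨fun ⟨a, ha, hx⟩ => h hx ha, fun hx => ⟨x, hx, le_refl x⟩⟩
  · intro h a b hba ha
    rw [← h]
    simp only [Set.mem_iUnion, Set.mem_ofPred_eq, exists_prop]
    exact ⟨a, ha, hba⟩

end Alexandrov

/-! ### Maximal Cohen-Macaulay modules -/

section MCM

open Classical in
/-- The depth of a module over a local ring: the supremum of the lengths of the regular sequences
on `M` consisting of elements of the maximal ideal; the zero module has depth `∞`. -/
noncomputable def depth (R : Type u) [CommRing R] [IsLocalRing R] (M : Type v) [AddCommGroup M]
    [Module R M] : ℕ∞ :=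
  if Subsingleton M then ⊤
  else ⨆ rs : {rs : List R //
      (∀ r ∈ rs, r ∈ IsLocalRing.maximalIdeal R) ∧ RingTheory.Sequence.IsRegular M rs},
    (rs.1.length : ℕ∞)

/-- Maximal Cohen-Macaulay modules: finitely generated modules whose depth is at least the Krull
dimension of the ring. -/
structure IsMCM (R : Type u) [CommRing R] [IsLocalRing R] (M : Type v) [AddCommGroup M]
    [Module R M] : Prop where
  finite : Module.Finite R M
  dim_le_depth : ringKrullDim R ≤ (depth R M : WithBot ℕ∞)

/-- (Strongly) Gorenstein rings: Noetherian rings `R` for which the regular module `R` has finite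
injective dimension. -/
structure IsGorenstein (R : Type u) [CommRing R] : Prop where
  isNoetherianRing : IsNoetherianRing R
  finite_injectiveDimension : ∃ n : ℕ, HasInjectiveDimensionLE (ModuleCat.of R R) n

end MCM

/-! ### The stable category of maximal Cohen-Macaulay modules -/

section Stable

/-- `P(M, N)`: the linear maps `M → N` which factor through a finitely generated projective
module. -/
def projMaps (R : Type u) [CommRing R] (M N : Type u) [AddCommGroup M] [Module R M]
    [AddCommGroup N] [Module R N] : Submodule R (M →ₗ[R] N) where
  carrier := {f | ∃ (P : ModuleCat.{u} R) (g : M →ₗ[R] P) (h : P →ₗ[R] N),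
    Module.Finite R P ∧ Module.Projective R P ∧ h ∘ₗ g = f}
  zero_mem' := ⟨ModuleCat.of R PUnit, 0, 0, inferInstance, inferInstance, by simp⟩
  add_mem' := by
    rintro _ _ ⟨P, g, h, hP, hP', rfl⟩ ⟨Q, g', h', hQ, hQ', rfl⟩
    refine ⟨ModuleCat.of R (P × Q), g.prod g', h.coprod h', ?_, ?_, ?_⟩
    · exact inferInstanceAs (Module.Finite R (P × Q))
    · exact inferInstanceAs (Module.Projective R (P × Q))
    · exact LinearMap.coprod_comp_prod h h' g g'
  smul_mem' := by
    rintro r _ ⟨P, g, h, hP, hP', rfl⟩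
    exact ⟨P, g, r • h, hP, hP', by rw [LinearMap.smul_comp]⟩

theorem projMaps_comp_left {R : Type u} [CommRing R] {L M N : Type u} [AddCommGroup L]
    [Module R L] [AddCommGroup M] [Module R M] [AddCommGroup N] [Module R N] {f : L →ₗ[R] M}
    (hf : f ∈ projMaps R L M) (k : M →ₗ[R] N) : k ∘ₗ f ∈ projMaps R L N := by
  obtain ⟨P, g, h, hP, hP', rfl⟩ := hf
  exact ⟨P, g, k ∘ₗ h, hP, hP', rfl⟩

theorem projMaps_comp_right {R : Type u} [CommRing R] {L M N : Type u} [AddCommGroup L]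
    [Module R L] [AddCommGroup M] [Module R M] [AddCommGroup N] [Module R N] {f : M →ₗ[R] N}
    (hf : f ∈ projMaps R M N) (k : L →ₗ[R] M) : f ∘ₗ k ∈ projMaps R L N := by
  obtain ⟨P, g, h, hP, hP', rfl⟩ := hf
  exact ⟨P, g ∘ₗ k, h, hP, hP', rfl⟩

/-- The stable Hom-module `Hom_R(M, N) / P(M, N)`. -/
abbrev StableHom (R : Type u) [CommRing R] (M N : Type u) [AddCommGroup M] [Module R M]
    [AddCommGroup N] [Module R N] : Type u :=
  (M →ₗ[R] N) ⧸ projMaps R M N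

/-- Composition of stable homomorphisms (in diagrammatic order), induced by composition of linear
maps. -/
def stableComp (R : Type u) [CommRing R] (L M N : Type u) [AddCommGroup L]
    [Module R L] [AddCommGroup M] [Module R M] [AddCommGroup N] [Module R N] :
    StableHom R L M →ₗ[R] StableHom R M N →ₗ[R] StableHom R L N :=
  (projMaps R L M).liftQ
    { toFun := fun f => (projMaps R M N).mapQ (projMaps R L N) (LinearMap.lcomp R N f)
        (fun _ hg => projMaps_comp_right hg f)
      map_add' := fun f f' => by
        ext g
        exact congrArg Submodule.Quotient.mk (LinearMap.comp_add f f' g)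
      map_smul' := fun r f => by
        ext g
        exact congrArg Submodule.Quotient.mk (LinearMap.comp_smul g r f) }
    (fun f hf => by
      rw [LinearMap.mem_ker]
      ext g
      exact (Submodule.Quotient.mk_eq_zero _).2 (projMaps_comp_left hf g))

theorem stableComp_mk (R : Type u) [CommRing R] (L M N : Type u) [AddCommGroup L]
    [Module R L] [AddCommGroup M] [Module R M] [AddCommGroup N] [Module R N]
    (f : L →ₗ[R] M) (g : M →ₗ[R] N) :
    stableComp R L M N (Submodule.Quotient.mk f) (Submodule.Quotient.mk g) =
      Submodule.Quotient.mk (g ∘ₗ f) := rfl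

/-- Objects of the stable category: maximal Cohen-Macaulay `R`-modules. -/
structure StableMCM (R : Type u) [CommRing R] [IsLocalRing R] : Type (u + 1) where
  module : ModuleCat.{u} R
  isMCM : IsMCM R module

variable (R : Type u) [CommRing R] [IsLocalRing R]

/-- The stable category of maximal Cohen-Macaulay modules: the morphisms from `M` to `N` are the
elements of `Hom_R(M, N) / P(M, N)`. -/
instance StableMCM.instCategory : Category.{u} (StableMCM R) where
  Hom M N := StableHom R M.module N.module
  id M := Submodule.Quotient.mk LinearMap.id
  comp {L M N} f g := stableComp R L.module M.module N.module f g
  id_comp {M N} f := by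
    induction f using Submodule.Quotient.induction_on with | H f => rfl
  comp_id {M N} f := by
    induction f using Submodule.Quotient.induction_on with | H f => rfl
  assoc {K L M N} f g h := by
    induction f using Submodule.Quotient.induction_on with | H f => ?_
    induction g using Submodule.Quotient.induction_on with | H g => ?_
    induction h using Submodule.Quotient.induction_on with | H h => rfl

instance StableMCM.instPreadditive : Preadditive (StableMCM R) where
  homGroup M N := inferInstanceAs (AddCommGroup (StableHom R M.module N.module))
  add_comp L M N := fun (f f' : StableHom R L.module M.module) g =>
    LinearMap.map_add₂ (stableComp R L.module M.module N.module) f f' g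
  comp_add L M N := fun f (g g' : StableHom R M.module N.module) =>
    map_add (stableComp R L.module M.module N.module f) g g'

instance StableMCM.instLinear : Linear R (StableMCM R) where
  homModule M N := inferInstanceAs (Module R (StableHom R M.module N.module))
  smul_comp L M N r := fun (f : StableHom R L.module M.module) g =>
    LinearMap.map_smul₂ (stableComp R L.module M.module N.module) r f g
  comp_smul L M N f r := fun (g : StableHom R M.module N.module) =>
    map_smul (stableComp R L.module M.module N.module f) r g

/-- The Alexandrov space `𝔠𝔐(R)` of the stable category of maximal Cohen-Macaulay
`R`-modules. -/
abbrev CM : Type (u + 1) := AlexandrovSpace R (StableMCM R)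

end Stable

/-! ### Orders -/

section Orders

/-- The canonical module `Hom_R(Λ, R)` of an algebra `Λ` over a Gorenstein ring `R`,
as a left `Λ`-module (see the instance below). -/
def CanonicalModule (R : Type u) [CommRing R] (Λ : Type v) [Ring Λ] [Algebra R Λ] :
    Type (max u v) :=
  Λ →ₗ[R] R

instance CanonicalModule.instAddCommGroup (R : Type u) [CommRing R] (Λ : Type v) [Ring Λ]
    [Algebra R Λ] : AddCommGroup (CanonicalModule R Λ) :=
  inferInstanceAs (AddCommGroup (Λ →ₗ[R] R))

/-- The left `Λ`-action on `Hom_R(Λ, R)`: `(a • f) x = f (x * a)`. -/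
instance CanonicalModule.instModule (R : Type u) [CommRing R] (Λ : Type v) [Ring Λ]
    [Algebra R Λ] : Module Λ (CanonicalModule R Λ) where
  smul a f := LinearMap.comp (show Λ →ₗ[R] R from f) (LinearMap.mulRight R a)
  one_smul f := LinearMap.ext fun x => congrArg (show Λ →ₗ[R] R from f) (mul_one x)
  mul_smul a b f := LinearMap.ext fun x =>
    congrArg (show Λ →ₗ[R] R from f) (mul_assoc x a b).symm
  smul_zero _ := LinearMap.ext fun _ => rfl
  smul_add _ _ _ := LinearMap.ext fun _ => rfl
  add_smul a b f := LinearMap.ext fun x =>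
    (congrArg (show Λ →ₗ[R] R from f) (mul_add x a b)).trans
      (map_add (show Λ →ₗ[R] R from f) (x * a) (x * b))
  zero_smul f := LinearMap.ext fun x =>
    (congrArg (show Λ →ₗ[R] R from f) (mul_zero x)).trans (map_zero (show Λ →ₗ[R] R from f))

/-- `Λ` has finite (left) global dimension: the projective dimensions of all `Λ`-modules
are bounded by a common natural number. -/
def HasFiniteGlobalDimension (Λ : Type u) [Ring Λ] : Prop :=
  ∃ n : ℕ, ∀ X : ModuleCat.{u} Λ, HasProjectiveDimensionLE X n

/-- A (not necessarily commutative) `R`-algebra `Λ` is an `R`-order if it is module-finite and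
maximal Cohen-Macaulay as an `R`-module; finite generation is part of `IsMCM`. -/
def IsOrder (R : Type u) [CommRing R] [IsLocalRing R] (Λ : Type v) [Ring Λ] [Algebra R Λ] :
    Prop :=
  IsMCM R Λ

/-- Gorenstein orders over a Gorenstein local ring: the canonical module is projective
over `Λ`. -/
structure IsGorensteinOrder (R : Type u) [CommRing R] [IsLocalRing R] (Λ : Type v) [Ring Λ]
    [Algebra R Λ] : Prop where
  isOrder : IsOrder R Λ
  projective : Module.Projective Λ (CanonicalModule R Λ)

/-- Nonsingular orders: Gorenstein orders of finite global dimension. -/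
structure IsNonsingularOrder (R : Type u) [CommRing R] [IsLocalRing R] (Λ : Type u) [Ring Λ]
    [Algebra R Λ] : Prop where
  isGorensteinOrder : IsGorensteinOrder R Λ
  hasFiniteGlobalDimension : HasFiniteGlobalDimension Λ

/-- The structure map `R → Λ` is a split monomorphism of `R`-modules. -/
def StructureMapSplits (R : Type u) [CommRing R] (Λ : Type v) [Ring Λ] [Algebra R Λ] : Prop :=
  ∃ s : Λ →ₗ[R] R, s ∘ₗ Algebra.linearMap R Λ = LinearMap.id

end Orders

end CMSpace

/-! The class of `Λ` is a least point of the space, and an open (upper) set containing a least point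
is everything. So it suffices that every MCM module `M` is an `R`-direct summand of some `Λⁿ`: a
scalar killing the stable endomorphisms of `Λ` then kills those of `M`
(`smul_id_mem_projMaps_of_retract_pi`).

The splitting `s` makes `M` a summand of `Hom_R(Λ, M)`, through `m ↦ s(·)m` and evaluation at `1`.
It remains to see that this finitely generated `Λ`-module is projective
(`projective_of_extVanishes`). It is MCM, which over a Gorenstein ring forces `Ext^i_R(-, R) = 0`
for `i ≥ 1` (`HasRegularPair.extVanishes`). A `Λ`-module in this class embeds in a power of the
projective module `ω = Hom_R(Λ, R)` with cokernel in the class (`exists_shortExact_of_extVanishes`),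
so cosyzygies can be taken indefinitely, and finite global dimension leaves only projective
dimension zero.

Dimension two enters because any Hom into a module of depth at least two again has depth at least
two (`HasRegularPair.linearMap`), with no condition on the source. -/

namespace CMSpace

open Abelian IsLocalRing Pointwise

/-! ### Vanishing of `Ext` into the ring -/

section ExtVanishing

/-- `Ext^n_R(X, R) = 0`. -/
def ExtVanishes (R : Type u) [CommRing R] (X : Type u) [AddCommGroup X] [Module R X] (n : ℕ) :
    Prop :=
  Subsingleton (Ext (ModuleCat.of R X) (ModuleCat.of R R) n)

variable {R : Type u} [CommRing R]
variable {A B C : Type u} [AddCommGroup A] [Module R A] [AddCommGroup B] [Module R B]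
  [AddCommGroup C] [Module R C] {f : A →ₗ[R] B} {g : B →ₗ[R] C}

theorem shortExact_of_exact (hf : Function.Injective f) (hg : Function.Surjective g)
    (h : Function.Exact f g) :
    (ModuleCat.shortComplexOfCompEqZero f g h.linearMap_comp_eq_zero).ShortExact :=
  ModuleCat.shortComplex_shortExact _ h hf hg

theorem ExtVanishes.left (hf : Function.Injective f) (hg : Function.Surjective g)
    (h : Function.Exact f g) {n : ℕ} (hB : ExtVanishes R B n) (hC : ExtVanishes R C (n + 1)) :
    ExtVanishes R A n := by
  refine subsingleton_of_forall_eq 0 fun x => ?_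
  obtain ⟨y, rfl⟩ := Ext.contravariant_sequence_exact₁ (shortExact_of_exact hf hg h) _ x
    (add_comm 1 n) (hC.elim _ _)
  rw [show y = 0 from hB.elim _ _, Ext.comp_zero]

theorem ExtVanishes.middle (hf : Function.Injective f) (hg : Function.Surjective g)
    (h : Function.Exact f g) {n : ℕ} (hA : ExtVanishes R A n) (hC : ExtVanishes R C n) :
    ExtVanishes R B n := by
  refine subsingleton_of_forall_eq 0 fun x => ?_
  obtain ⟨y, rfl⟩ := Ext.contravariant_sequence_exact₂ (shortExact_of_exact hf hg h) _ x
    (hA.elim _ _)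
  rw [show y = 0 from hC.elim _ _, Ext.comp_zero]

theorem ExtVanishes.right (hf : Function.Injective f) (hg : Function.Surjective g)
    (h : Function.Exact f g) {n : ℕ} (hA : ExtVanishes R A n) (hB : ExtVanishes R B (n + 1)) :
    ExtVanishes R C (n + 1) := by
  refine subsingleton_of_forall_eq 0 fun x => ?_
  obtain ⟨y, rfl⟩ := Ext.contravariant_sequence_exact₃ (shortExact_of_exact hf hg h) _ x
    (hB.elim _ _) (add_comm 1 n)
  rw [show y = 0 from hA.elim _ _, Ext.comp_zero]

theorem ExtVanishes.of_subsingleton [Subsingleton A] (n : ℕ) : ExtVanishes R A n := by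
  have : Limits.IsZero (ModuleCat.of R A) := ModuleCat.isZero_of_subsingleton _
  have := this.hasProjectiveDimensionLT_zero
  exact HasProjectiveDimensionLT.subsingleton _ 0 n (Nat.zero_le n) _

theorem ExtVanishes.of_projective [Module.Projective R A] {n : ℕ} (hn : 1 ≤ n) :
    ExtVanishes R A n := by
  have : Projective (ModuleCat.of R A) := (IsProjective.iff_projective A).1 inferInstance
  exact HasProjectiveDimensionLT.subsingleton _ 1 n hn _

theorem ExtVanishes.of_equiv (e : A ≃ₗ[R] B) {n : ℕ} (hA : ExtVanishes R A n) :
    ExtVanishes R B n :=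
  ExtVanishes.middle (f := e.toLinearMap) (g := (0 : B →ₗ[R] PUnit.{u + 1})) e.injective
    (fun _ => ⟨0, rfl⟩) (fun y => ⟨fun _ => e.surjective y, fun _ => rfl⟩) hA
    (ExtVanishes.of_subsingleton n)

theorem ExtVanishes.pi {ι : Type} [Finite ι] {n : ℕ} (hA : ExtVanishes R A n) :
    ExtVanishes R (ι → A) n := by
  induction ι using Finite.induction_empty_option with
  | of_equiv e ih => exact ih.of_equiv (LinearEquiv.funCongrLeft R A e.symm)
  | h_empty => exact ExtVanishes.of_subsingleton n
  | h_option ih =>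
    refine ExtVanishes.of_equiv (LinearEquiv.piOptionEquivProd R (M := fun _ => A)).symm ?_
    exact ExtVanishes.middle (f := LinearMap.inl R A _) (g := LinearMap.snd R A _)
      LinearMap.inl_injective LinearMap.snd_surjective .inl_snd hA ih

theorem ExtVanishes.exists_extension (hf : Function.Injective f) (hg : Function.Surjective g)
    (h : Function.Exact f g) (hC : ExtVanishes R C 1) (φ : A →ₗ[R] R) :
    ∃ ψ : B →ₗ[R] R, ψ ∘ₗ f = φ := by
  obtain ⟨y, hy⟩ := Ext.contravariant_sequence_exact₁ (shortExact_of_exact hf hg h)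
    (ModuleCat.of R R) (Ext.mk₀ (ModuleCat.ofHom φ)) (add_zero 1) (hC.elim _ _)
  obtain ⟨ψ, rfl⟩ := Ext.homEquiv₀.symm.surjective y
  rw [Ext.homEquiv₀_symm_apply, Ext.mk₀_comp_mk₀] at hy
  have := Ext.homEquiv₀.symm.injective hy
  exact ⟨ψ.hom, congrArg ModuleCat.Hom.hom this⟩

/-- A class in `Ext^1(C, R)` is the image of a form on `A` under the connecting map. If the form
extends to `B` it factors through `f`, whose composite with the extension class is zero. -/
theorem ExtVanishes.of_forall_exists_extension (hf : Function.Injective f)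
    (hg : Function.Surjective g) (h : Function.Exact f g) (hB : ExtVanishes R B 1)
    (H : ∀ φ : A →ₗ[R] R, ∃ ψ : B →ₗ[R] R, ψ ∘ₗ f = φ) : ExtVanishes R C 1 := by
  refine subsingleton_of_forall_eq 0 fun x => ?_
  obtain ⟨y, rfl⟩ := Ext.contravariant_sequence_exact₃ (shortExact_of_exact hf hg h) _ x
    (hB.elim _ _) (add_zero 1)
  obtain ⟨φ, rfl⟩ := Ext.homEquiv₀.symm.surjective y
  obtain ⟨ψ, hψ⟩ := H φ.hom
  have : φ = (ModuleCat.shortComplexOfCompEqZero f g h.linearMap_comp_eq_zero).f ≫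
      ModuleCat.ofHom ψ := by
    ext1; exact hψ.symm
  rw [Ext.homEquiv₀_symm_apply, this, ← Ext.mk₀_comp_mk₀, ← Ext.comp_assoc_of_second_deg_zero,
    ShortComplex.ShortExact.extClass_comp, Ext.zero_comp]

variable {X : Type u} [AddCommGroup X] [Module R X]

theorem ExtVanishes.quotSMulTop {r : R} (hr : IsSMulRegular X r) {n : ℕ}
    (h : ExtVanishes R X n) (h' : ExtVanishes R X (n + 1)) :
    ExtVanishes R (QuotSMulTop r X) (n + 1) :=
  ExtVanishes.right (f := LinearMap.lsmul R X r) (g := (r • (⊤ : Submodule R X)).mkQ) hr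
    (Submodule.mkQ_surjective _) (LinearMap.exact_lsmul_mkQ_smul_top X r) h h'

/-- The long exact sequence makes multiplication by `r` surjective on the finitely generated module
`Ext^n(X, R)`, so Nakayama applies. -/
theorem ExtVanishes.of_quotSMulTop [IsLocalRing R] [IsNoetherianRing R] [Module.Finite R X]
    {r : R} (hrm : r ∈ maximalIdeal R) (hr : IsSMulRegular X r) {n : ℕ}
    (h : ExtVanishes R (QuotSMulTop r X) (n + 1)) : ExtVanishes R X n := by
  have hS := (show IsSMulRegular (ModuleCat.of R X) r from hr).smulShortComplex_shortExact
  have key : (⊤ : Submodule R (Ext (ModuleCat.of R X) (ModuleCat.of R R) n)) ≤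
      maximalIdeal R • ⊤ := by
    intro x _
    obtain ⟨y, rfl⟩ := Ext.contravariant_sequence_exact₁ hS _ x (add_comm 1 n) (h.elim _ _)
    have hsmul (Z : ModuleCat.{u} R) (y : Ext Z (ModuleCat.of R R) n) :
        (Ext.mk₀ (r • 𝟙 Z)).comp y (zero_add n) = r • y := by
      rw [Ext.mk₀_smul, Ext.smul_comp, Ext.mk₀_id_comp]
    have : (Ext.mk₀ ((ModuleCat.of R X).smulShortComplex r).f).comp y (zero_add n) = r • y :=
      hsmul (ModuleCat.of R X) y
    rw [this]
    exact Submodule.smul_mem_smul hrm trivial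
  have := Submodule.eq_bot_of_le_smul_of_le_jacobson_bot _ _ Module.Finite.fg_top key
    (maximalIdeal_le_jacobson _)
  exact (Submodule.subsingleton_iff R).1 (subsingleton_of_bot_eq_top this.symm)

end ExtVanishing

/-! ### Modules with a regular sequence of length two -/

section RegularPair

/-- `X` has a weakly regular sequence of length two in the maximal ideal. -/
def HasRegularPair (R : Type u) [CommRing R] [IsLocalRing R] (X : Type v) [AddCommGroup X]
    [Module R X] : Prop :=
  ∃ a ∈ maximalIdeal R, ∃ b ∈ maximalIdeal R, IsSMulRegular X a ∧
    ∀ x y : X, b • x = a • y → ∃ z, x = a • z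

variable {R : Type u} [CommRing R] [IsLocalRing R] {X : Type v} [AddCommGroup X] [Module R X]

omit [IsLocalRing R] in
theorem isSMulRegular_quotSMulTop_iff {a b : R} :
    IsSMulRegular (QuotSMulTop a X) b ↔ ∀ x y : X, b • x = a • y → ∃ z, x = a • z := by
  rw [isSMulRegular_iff_right_eq_zero_of_smul]
  constructor
  · intro h x y hxy
    have := h (Submodule.Quotient.mk x) (by
      rw [← Submodule.Quotient.mk_smul, Submodule.Quotient.mk_eq_zero, hxy]
      exact Submodule.smul_mem_pointwise_smul _ _ _ trivial)
    rw [Submodule.Quotient.mk_eq_zero, Submodule.mem_smul_pointwise_iff_exists] at this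
    obtain ⟨z, -, hz⟩ := this
    exact ⟨z, hz.symm⟩
  · intro h x hx
    induction x using Submodule.Quotient.induction_on with | H x => ?_
    rw [← Submodule.Quotient.mk_smul, Submodule.Quotient.mk_eq_zero,
      Submodule.mem_smul_pointwise_iff_exists] at hx
    obtain ⟨y, -, hy⟩ := hx
    obtain ⟨z, rfl⟩ := h x y hy.symm
    rw [Submodule.Quotient.mk_eq_zero]
    exact Submodule.smul_mem_pointwise_smul _ _ _ trivial

theorem IsMCM.hasRegularPair (hR : ringKrullDim R = 2) (h : IsMCM R X) : HasRegularPair R X := by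
  rcases subsingleton_or_nontrivial X with hX | hX
  · exact ⟨0, zero_mem _, 0, zero_mem _, fun _ _ _ => Subsingleton.elim _ _,
      fun _ _ _ => ⟨0, Subsingleton.elim _ _⟩⟩
  have h2 := h.dim_le_depth
  rw [hR, depth, if_neg (not_subsingleton X)] at h2
  -- A strict bound on the supremum yields an actual regular sequence of length at least two,
  -- without the supremum having to be attained.
  have h3 : (1 : ℕ∞) < ⨆ rs : {rs : List R //
      (∀ r ∈ rs, r ∈ maximalIdeal R) ∧ RingTheory.Sequence.IsRegular X rs},
      (rs.1.length : ℕ∞) :=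
    lt_of_lt_of_le (by norm_num) (WithBot.coe_le_coe.1 h2)
  obtain ⟨⟨rs, hm, hreg⟩, hlen⟩ := lt_iSup_iff.1 h3
  match rs, hm, hreg, hlen with
  | a :: b :: rs, hm, hreg, _ =>
    rw [RingTheory.Sequence.isRegular_cons_iff, RingTheory.Sequence.isRegular_cons_iff] at hreg
    exact ⟨a, hm a (by simp), b, hm b (by simp), hreg.1,
      isSMulRegular_quotSMulTop_iff.1 hreg.2.1⟩
  | [], _, _, hlen => simp at hlen
  | [a], _, _, hlen => simp at hlen

theorem HasRegularPair.of_retract {Y : Type w} [AddCommGroup Y] [Module R Y]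
    (h : HasRegularPair R Y) (i : X →ₗ[R] Y) (s : Y →ₗ[R] X) (hs : s ∘ₗ i = LinearMap.id) :
    HasRegularPair R X := by
  have hs' (x : X) : s (i x) = x := LinearMap.congr_fun hs x
  obtain ⟨a, ha, b, hb, hreg, hdiv⟩ := h
  refine ⟨a, ha, b, hb, fun x y hxy => ?_, fun x y hxy => ?_⟩
  · rw [← hs' x, ← hs' y]
    exact congrArg s (hreg (by simpa using congrArg i hxy))
  · obtain ⟨z, hz⟩ := hdiv (i x) (i y) (by simpa using congrArg i hxy)
    exact ⟨s z, by rw [← map_smul, ← hz, hs']⟩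

/-- Division by `a` is done pointwise; since `a` is regular the quotient is unique, hence linear. -/
theorem HasRegularPair.linearMap {Y : Type w} [AddCommGroup Y] [Module R Y]
    (h : HasRegularPair R X) : HasRegularPair R (Y →ₗ[R] X) := by
  obtain ⟨a, ha, b, hb, hreg, hdiv⟩ := h
  refine ⟨a, ha, b, hb, fun f g hfg => ?_, fun f g hfg => ?_⟩
  · ext y
    exact hreg (LinearMap.congr_fun hfg y)
  · choose z hz using fun y => hdiv (f y) (g y) (LinearMap.congr_fun hfg y)
    refine ⟨{ toFun := z, map_add' := fun x y => hreg ?_, map_smul' := fun r y => hreg ?_ },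
      LinearMap.ext hz⟩
    · simp only [smul_add, ← hz, map_add]
    · simp only [RingHom.id_apply, smul_comm a r, ← hz, map_smul]

end RegularPair

/-! ### Gorenstein rings of dimension two -/

section DimensionTwo

variable {R : Type u} [CommRing R] [IsLocalRing R] [IsNoetherianRing R]

omit [IsLocalRing R] in
theorem isFiniteLength_of_supportDim_le_zero {X : Type v} [AddCommGroup X] [Module R X]
    [Module.Finite R X] (h : Module.supportDim R X ≤ 0) : IsFiniteLength R X := by
  have hann : ringKrullDim (R ⧸ Module.annihilator R X) ≤ 0 := by
    rwa [← Module.supportDim_eq_ringKrullDim_quotient_annihilator]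
  have : IsArtinianRing (R ⧸ Module.annihilator R X) := by
    rw [isArtinianRing_iff_krullDimLE_zero, Ring.KrullDimLE, Order.krullDimLE_iff]
    exact hann
  let _ : Module (R ⧸ Module.annihilator R X) X := Module.quotientAnnihilator
  have : IsScalarTower R (R ⧸ Module.annihilator R X) X := .of_algebraMap_smul fun _ _ => rfl
  have : Module.Finite (R ⧸ Module.annihilator R X) X := Module.Finite.of_restrictScalars_finite R _ _
  rw [isFiniteLength_iff_isNoetherian_isArtinian]
  exact ⟨inferInstance, isArtinian_of_surjective_algebraMap
    (S := R) (R := R ⧸ Module.annihilator R X) Ideal.Quotient.mk_surjective⟩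

/-- Each regular element lowers the dimension of the support by one, starting from at most two. -/
theorem isFiniteLength_quotSMulTop_quotSMulTop (hR : ringKrullDim R = 2) {X : Type v}
    [AddCommGroup X] [Module R X] [Module.Finite R X] {a b : R} (ha : a ∈ maximalIdeal R)
    (hb : b ∈ maximalIdeal R) (hareg : IsSMulRegular X a)
    (hbreg : IsSMulRegular (QuotSMulTop a X) b) :
    IsFiniteLength R (QuotSMulTop b (QuotSMulTop a X)) := by
  apply isFiniteLength_of_supportDim_le_zero
  have h1 := Module.supportDim_quotSMulTop_succ_eq_supportDim hareg ha
  have h2 := Module.supportDim_quotSMulTop_succ_eq_supportDim hbreg hb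
  have h3 : Module.supportDim R X ≤ 2 := hR ▸ Module.supportDim_le_ringKrullDim R X
  rw [← h1, ← h2, show (2 : WithBot ℕ∞) = 0 + 1 + 1 by norm_num] at h3
  simpa only [ENat.WithBot.add_le_add_one_right_iff] using h3

-- A nonzero Artinian module has a simple submodule, and over a local ring all simple modules are
-- isomorphic to the residue field.
omit [IsNoetherianRing R] in
theorem exists_injective_of_isSimpleModule {X : Type v} [AddCommGroup X] [Module R X]
    [Nontrivial X] [IsArtinian R X] (S : Type w) [AddCommGroup S] [Module R S]
    [IsSimpleModule R S] : ∃ f : S →ₗ[R] X, Function.Injective f := by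
  have : IsAtomic (Submodule R X) := isAtomic_of_orderBot_wellFounded_lt wellFounded_lt
  obtain ⟨T, hT, -⟩ := (eq_bot_or_exists_atom_le (⊤ : Submodule R X)).resolve_left top_ne_bot
  have : IsSimpleModule R T := isSimpleModule_iff_isAtom.2 hT
  obtain ⟨I, hI, ⟨e⟩⟩ := isSimpleModule_iff_quot_maximal (R := R) (M := S) |>.1 inferInstance
  obtain ⟨J, hJ, ⟨e'⟩⟩ := isSimpleModule_iff_quot_maximal (R := R) (M := T) |>.1 inferInstance
  obtain rfl : I = J := (eq_maximalIdeal hI).trans (eq_maximalIdeal hJ).symm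
  exact ⟨T.subtype ∘ₗ (e.trans e'.symm).toLinearMap,
    T.injective_subtype.comp (e.trans e'.symm).injective⟩

/-- Finite-length modules have no `Ext` into `R` in degrees above the dimension. -/
theorem ExtVanishes.of_isFiniteLength (hR : IsGorenstein R) (hdim : ringKrullDim R = 2)
    (hreg : HasRegularPair R R) {n : ℕ} (hn : 3 ≤ n) {X : Type u} [AddCommGroup X] [Module R X]
    (hX : IsFiniteLength R X) : ExtVanishes R X n := by
  obtain ⟨N, hN⟩ := hR.finite_injectiveDimension
  obtain ⟨a, ha, b, hb, hareg, hdiv⟩ := hreg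
  have hbreg := isSMulRegular_quotSMulTop_iff.2 hdiv
  let K := QuotSMulTop b (QuotSMulTop a R)
  have hK : IsFiniteLength R K := isFiniteLength_quotSMulTop_quotSMulTop hdim ha hb hareg hbreg
  have : IsArtinian R K := (isFiniteLength_iff_isNoetherian_isArtinian.1 hK).2
  have : Nontrivial (QuotSMulTop a R) := nontrivial_quotSMulTop_of_mem_maximalIdeal R ha
  have : Nontrivial K := nontrivial_quotSMulTop_of_mem_maximalIdeal (QuotSMulTop a R) hb
  -- `R` has no `Ext` from degree 1 on; each of the two quotients by a regular element raises this
  -- threshold by one.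
  have hKvan (n : ℕ) (hn : 3 ≤ n) : ExtVanishes R K n := by
    obtain ⟨m, rfl⟩ := Nat.exists_eq_add_of_le' hn
    exact .quotSMulTop hbreg
      (.quotSMulTop hareg (.of_projective (by lia)) (.of_projective (by lia)))
      (.quotSMulTop hareg (.of_projective (by lia)) (.of_projective (by lia)))
  -- Descending induction on the degree `n`, with `k` bounding the distance to `N + 1`, from where
  -- the injective dimension of `R` kills every `Ext`.
  suffices ∀ k n, 3 ≤ n → N + 1 ≤ n + k → ∀ (X : Type u) [AddCommGroup X] [Module R X],
      IsFiniteLength R X → ExtVanishes R X n from this (N + 1) n hn (by lia) X hX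
  intro k
  induction k with
  | zero =>
    intro n _ hn X _ _ _
    exact HasInjectiveDimensionLT.subsingleton (ModuleCat.of R R) (N + 1) n hn _
  | succ k ih =>
    intro n hn hnk X _ _ hX
    induction hX with
    | of_subsingleton => exact .of_subsingleton n
    | @of_simple_quotient X _ _ Y hS hY ihY =>
      refine ExtVanishes.middle Y.injective_subtype Y.mkQ_surjective
        (LinearMap.exact_subtype_mkQ Y) ihY ?_
      -- For the simple factor `S` embedded in `K`, `Ext^n(S)` lies between `Ext^n(K) = 0` and
      -- `Ext^(n+1)(K/S)`, which vanishes by the induction on degree.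
      obtain ⟨f, hf⟩ := exists_injective_of_isSimpleModule (R := R) (X := K) (X ⧸ Y)
      exact ExtVanishes.left hf (Submodule.mkQ_surjective _) (LinearMap.exact_map_mkQ_range f)
        (hKvan n hn) (ih (n + 1) (by lia) (by lia) _
          (hK.of_surjective (Submodule.mkQ_surjective (LinearMap.range f))))

/-- Maximal Cohen-Macaulay modules have no higher `Ext` into `R`. -/
theorem HasRegularPair.extVanishes (hR : IsGorenstein R) (hdim : ringKrullDim R = 2)
    (hreg : HasRegularPair R R) {X : Type u} [AddCommGroup X] [Module R X] [Module.Finite R X]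
    (hX : HasRegularPair R X) {n : ℕ} (hn : 1 ≤ n) : ExtVanishes R X n := by
  obtain ⟨a, ha, b, hb, hareg, hdiv⟩ := hX
  have hbreg := isSMulRegular_quotSMulTop_iff.2 hdiv
  exact .of_quotSMulTop ha hareg (.of_quotSMulTop hb hbreg (.of_isFiniteLength hR hdim hreg
    (by lia) (isFiniteLength_quotSMulTop_quotSMulTop hdim ha hb hareg hbreg)))

end DimensionTwo

/-! ### Biduality -/

section Biduality

variable {R : Type u} [CommRing R] [IsNoetherianRing R]

/-- A finite module with `Ext^1_R(X, R) = 0` surjects onto its bidual, when duals have no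
first `Ext` into `R`. -/
theorem surjective_dual_eval_of_extVanishes
    (H : ∀ (Y : Type u) [AddCommGroup Y] [Module R Y] [Module.Finite R Y],
      ExtVanishes R (Y →ₗ[R] R) 1)
    {X : Type u} [AddCommGroup X] [Module R X] [Module.Finite R X] (h1 : ExtVanishes R X 1) :
    Function.Surjective (Module.Dual.eval R X) := by
  intro φ
  obtain ⟨n, π, hπ⟩ := Module.Finite.exists_fin' R X
  let ι := (LinearMap.ker π).subtype
  have hι : Function.Injective ι := Submodule.injective_subtype _
  have hex : Function.Exact ι π := LinearMap.exact_subtype_ker_map π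
  have hsurj : Function.Surjective (LinearMap.lcomp R R ι) := h1.exists_extension hι hπ hex
  -- The dual sequence `0 → X* → F* → K* → 0` is exact, with `F` free of rank `n` and `K = ker π`.
  -- As `Ext^1(K*, R) = 0`, `φ` extends to `F*`, where it is evaluation at a vector.
  obtain ⟨ψ, hψ⟩ := ExtVanishes.exists_extension
    (LinearMap.lcomp_injective_of_surjective π hπ) hsurj
    (LinearMap.exact_lcomp_of_exact_of_surjective R hex hπ) (H (LinearMap.ker π)) φ
  obtain ⟨y, rfl⟩ := (Module.bijective_dual_eval R (Fin n → R)).2 ψ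
  exact ⟨π y, hψ⟩

/-- For `K → F → X` with `F` free, `Ext^1(K, R) = Ext^2(X, R) = 0`, so `K` surjects onto its bidual.
A lift to `F` of an element killed by all forms comes from `K**`, hence from `K`. -/
theorem injective_dual_eval_of_extVanishes
    (H : ∀ (Y : Type u) [AddCommGroup Y] [Module R Y] [Module.Finite R Y],
      ExtVanishes R (Y →ₗ[R] R) 1)
    {X : Type u} [AddCommGroup X] [Module R X] [Module.Finite R X] (h1 : ExtVanishes R X 1)
    (h2 : ExtVanishes R X 2) : Function.Injective (Module.Dual.eval R X) := by
  rw [injective_iff_map_eq_zero]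
  intro x hx
  obtain ⟨n, π, hπ⟩ := Module.Finite.exists_fin' R X
  let ι := (LinearMap.ker π).subtype
  have hι : Function.Injective ι := Submodule.injective_subtype _
  have hex : Function.Exact ι π := LinearMap.exact_subtype_ker_map π
  have hK : ExtVanishes R (LinearMap.ker π) 1 := .left hι hπ hex (.of_projective le_rfl) h2
  obtain ⟨y, rfl⟩ := hπ x
  have hsurj : Function.Surjective (LinearMap.lcomp R R ι) := h1.exists_extension hι hπ hex
  have hexact := LinearMap.exact_lcomp_of_exact_of_surjective R
    (LinearMap.exact_lcomp_of_exact_of_surjective R hex hπ) hsurj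
  obtain ⟨φ, hφ⟩ := (hexact (Module.Dual.eval R _ y)).1 hx
  obtain ⟨k, rfl⟩ := surjective_dual_eval_of_extVanishes H hK φ
  have : y = ι k := (Module.bijective_dual_eval R (Fin n → R)).1 hφ.symm
  rw [this, hex.apply_apply_eq_zero]

end Biduality

/-! ### Coinduced modules -/

section Coinduced

variable (R : Type u) [CommRing R] (Λ : Type u) [Ring Λ] [Algebra R Λ]

instance CanonicalModule.instModuleBase : Module R (CanonicalModule R Λ) :=
  inferInstanceAs (Module R (Λ →ₗ[R] R))

instance CanonicalModule.instIsScalarTower : IsScalarTower R Λ (CanonicalModule R Λ) where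
  smul_assoc r a f := LinearMap.ext fun x =>
    (congrArg (show Λ →ₗ[R] R from f) (mul_smul_comm r x a)).trans
      (map_smul (show Λ →ₗ[R] R from f) r (x * a))

/-- The coinduced left `Λ`-module `Hom_R(Λ, M)`, with `(a • f) x = f (x * a)`. -/
def CoinducedModule (M : Type u) [AddCommGroup M] [Module R M] : Type u :=
  Λ →ₗ[R] M

variable (M : Type u) [AddCommGroup M] [Module R M]

instance CoinducedModule.instAddCommGroup : AddCommGroup (CoinducedModule R Λ M) :=
  inferInstanceAs (AddCommGroup (Λ →ₗ[R] M))

instance CoinducedModule.instModuleBase : Module R (CoinducedModule R Λ M) :=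
  inferInstanceAs (Module R (Λ →ₗ[R] M))

instance CoinducedModule.instModule : Module Λ (CoinducedModule R Λ M) where
  smul a f := LinearMap.comp (show Λ →ₗ[R] M from f) (LinearMap.mulRight R a)
  one_smul f := LinearMap.ext fun x => congrArg (show Λ →ₗ[R] M from f) (mul_one x)
  mul_smul a b f := LinearMap.ext fun x =>
    congrArg (show Λ →ₗ[R] M from f) (mul_assoc x a b).symm
  smul_zero _ := LinearMap.ext fun _ => rfl
  smul_add _ _ _ := LinearMap.ext fun _ => rfl
  add_smul a b f := LinearMap.ext fun x =>
    (congrArg (show Λ →ₗ[R] M from f) (mul_add x a b)).trans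
      (map_add (show Λ →ₗ[R] M from f) (x * a) (x * b))
  zero_smul f := LinearMap.ext fun x =>
    (congrArg (show Λ →ₗ[R] M from f) (mul_zero x)).trans (map_zero (show Λ →ₗ[R] M from f))

instance CoinducedModule.instIsScalarTower : IsScalarTower R Λ (CoinducedModule R Λ M) where
  smul_assoc r a f := LinearMap.ext fun x =>
    (congrArg (show Λ →ₗ[R] M from f) (mul_smul_comm r x a)).trans
      (map_smul (show Λ →ₗ[R] M from f) r (x * a))

variable {R Λ} {X : Type u} [AddCommGroup X] [Module R X] [Module Λ X] [IsScalarTower R Λ X]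

/-- The `Λ`-linear map `X → Hom_R(Λ, R)` corresponding to an `R`-linear form on `X`. -/
def toCanonicalModule (φ : X →ₗ[R] R) : X →ₗ[Λ] CanonicalModule R Λ where
  toFun x := φ ∘ₗ (LinearMap.toSpanSingleton Λ X x).restrictScalars R
  map_add' x y := LinearMap.ext fun a =>
    (congrArg φ (smul_add a x y)).trans (map_add φ _ _)
  map_smul' a x := LinearMap.ext fun b =>
    congrArg φ (mul_smul b a x).symm

end Coinduced

/-! ### Modules over nonsingular orders -/

section Orders

variable {R : Type u} [CommRing R] [IsNoetherianRing R] {Λ : Type u} [Ring Λ] [Algebra R Λ]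

omit [IsNoetherianRing R] in
theorem ExtVanishes.quotient_range {X P : Type u} [AddCommGroup X] [Module R X] [Module Λ X]
    [IsScalarTower R Λ X] [AddCommGroup P] [Module R P] [Module Λ P] [IsScalarTower R Λ P]
    {f : X →ₗ[Λ] P} (hf : Function.Injective f)
    (hext : Function.Surjective (LinearMap.lcomp R R (f.restrictScalars R)))
    (hX : ∀ n, 1 ≤ n → ExtVanishes R X n) (hP : ∀ n, 1 ≤ n → ExtVanishes R P n) {n : ℕ}
    (hn : 1 ≤ n) : ExtVanishes R (P ⧸ LinearMap.range f) n := by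
  have hinj : Function.Injective (f.restrictScalars R) := hf
  have hsurj : Function.Surjective ((LinearMap.range f).mkQ.restrictScalars R) :=
    (LinearMap.range f).mkQ_surjective
  have hex : Function.Exact (f.restrictScalars R) ((LinearMap.range f).mkQ.restrictScalars R) :=
    LinearMap.exact_map_mkQ_range f
  obtain rfl | hn := hn.eq_or_lt
  · have := ExtVanishes.of_forall_exists_extension hinj hsurj hex (hP 1 le_rfl) hext
    exact this
  · obtain ⟨m, rfl⟩ := Nat.exists_eq_add_of_lt hn
    have := ExtVanishes.right hinj hsurj hex (hX (1 + m) (by lia)) (hP (1 + m + 1) (by lia))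
    exact this

omit [IsNoetherianRing R] in
theorem HasProjectiveDimensionLE.of_quotient_range {X P : Type u} [AddCommGroup X] [Module Λ X]
    [AddCommGroup P] [Module Λ P] [Module.Projective Λ P] {f : X →ₗ[Λ] P}
    (hf : Function.Injective f) {k : ℕ}
    (h : HasProjectiveDimensionLE (ModuleCat.of Λ (P ⧸ LinearMap.range f)) (k + 1)) :
    HasProjectiveDimensionLE (ModuleCat.of Λ X) k := by
  have : Projective (ModuleCat.of Λ P) := (IsProjective.iff_projective P).1 inferInstance
  have hP : HasProjectiveDimensionLT (ModuleCat.of Λ P) (k + 1) :=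
    hasProjectiveDimensionLT_of_ge _ 1 _ (by lia)
  exact (ModuleCat.shortComplex_shortExact (ModuleCat.shortComplexOfCompEqZero f
    (LinearMap.range f).mkQ (LinearMap.exact_map_mkQ_range f).linearMap_comp_eq_zero)
    (LinearMap.exact_map_mkQ_range f) hf
    (Submodule.mkQ_surjective _)).hasProjectiveDimensionLT_X₁ (k + 1) hP h

/-- Every `Λ`-module which is maximal Cohen-Macaulay in the `Ext` sense embeds into a projective
`Λ`-module with cokernel of the same kind. -/
theorem exists_shortExact_of_extVanishes
    (H : ∀ (Y : Type u) [AddCommGroup Y] [Module R Y] [Module.Finite R Y], ∀ n, 1 ≤ n →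
      ExtVanishes R (Y →ₗ[R] R) n) [Module.Finite R Λ]
    [Module.Projective Λ (CanonicalModule R Λ)]
    (X : Type u) [AddCommGroup X] [Module R X] [Module Λ X] [IsScalarTower R Λ X]
    [Module.Finite R X] (hX : ∀ n, 1 ≤ n → ExtVanishes R X n) :
    ∃ (n : ℕ) (f : X →ₗ[Λ] (Fin n → CanonicalModule R Λ)), Function.Injective f ∧
      ∀ k, 1 ≤ k → ExtVanishes R ((Fin n → CanonicalModule R Λ) ⧸ LinearMap.range f) k := by
  obtain ⟨n, F, hF⟩ := Module.Finite.exists_fin (R := R) (M := X →ₗ[R] R)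
  let f : X →ₗ[Λ] (Fin n → CanonicalModule R Λ) := LinearMap.pi fun i => toCanonicalModule (F i)
  have hext : Function.Surjective (LinearMap.lcomp R R (f.restrictScalars R)) := by
    rw [← LinearMap.range_eq_top, eq_top_iff, ← hF, Submodule.span_le]
    rintro _ ⟨i, rfl⟩
    -- The generator `F i` is recovered from `f` by evaluating its `i`-th coordinate at `1`. So all
    -- forms on `X` extend along `f`, which gives both injectivity and the vanishing of `Ext^1` of
    -- the cokernel.
    refine ⟨(LinearMap.applyₗ (R := R) (M₂ := R) (1 : Λ)) ∘ₗ
      (LinearMap.proj i : (Fin n → CanonicalModule R Λ) →ₗ[R] CanonicalModule R Λ), ?_⟩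
    ext x
    change F i ((1 : Λ) • x) = F i x
    rw [one_smul]
  have hinj : Function.Injective f := by
    rw [injective_iff_map_eq_zero]
    intro x hx
    apply (injective_iff_map_eq_zero _).1 (injective_dual_eval_of_extVanishes
      (fun Y _ _ _ => H Y 1 le_rfl) (hX 1 le_rfl) (hX 2 (by lia)))
    ext ψ
    obtain ⟨χ, rfl⟩ := hext ψ
    change χ (f x) = 0
    rw [hx, map_zero]
  have hω (k : ℕ) (hk : 1 ≤ k) : ExtVanishes R (CanonicalModule R Λ) k := H Λ k hk
  exact ⟨n, f, hinj, fun k hk => .quotient_range hinj hext hX (fun m hm => (hω m hm).pi) hk⟩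

/-- If all modules of the class have projective dimension at most `k + 1`, each is the kernel of a
map from a projective onto a member of the class, so the bound improves to `k`. Starting from the
global dimension, it descends to zero. -/
theorem projective_of_extVanishes
    (H : ∀ (Y : Type u) [AddCommGroup Y] [Module R Y] [Module.Finite R Y], ∀ n, 1 ≤ n →
      ExtVanishes R (Y →ₗ[R] R) n) [Module.Finite R Λ]
    [Module.Projective Λ (CanonicalModule R Λ)] (hΛ : HasFiniteGlobalDimension Λ)
    (X : Type u) [AddCommGroup X] [Module R X] [Module Λ X] [IsScalarTower R Λ X]
    [Module.Finite R X] (hX : ∀ n, 1 ≤ n → ExtVanishes R X n) : Module.Projective Λ X := by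
  obtain ⟨d, hd⟩ := hΛ
  suffices ∀ k, (∀ (X : Type u) [AddCommGroup X] [Module R X] [Module Λ X] [IsScalarTower R Λ X]
      [Module.Finite R X], (∀ n, 1 ≤ n → ExtVanishes R X n) →
      HasProjectiveDimensionLE (ModuleCat.of Λ X) k) → Module.Projective Λ X from
    this d fun Y _ _ _ _ _ _ => hd _
  intro k
  induction k with
  | zero =>
    intro h
    rw [IsProjective.iff_projective, projective_iff_hasProjectiveDimensionLE_zero]
    exact h X hX
  | succ k ih =>
    refine fun h => ih fun Y _ _ _ _ _ hY => ?_
    obtain ⟨n, f, hf, hcoker⟩ := exists_shortExact_of_extVanishes H (Λ := Λ) Y hY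
    have : Module.Finite R (CanonicalModule R Λ) := inferInstanceAs (Module.Finite R (Λ →ₗ[R] R))
    have : Module.Finite R ((Fin n → CanonicalModule R Λ) ⧸ LinearMap.range f) :=
      Module.Finite.of_surjective ((LinearMap.range f).mkQ.restrictScalars R)
        (LinearMap.range f).mkQ_surjective
    have : Module.Projective Λ (Fin n → CanonicalModule R Λ) :=
      .of_equiv' (DFinsupp.linearEquivFunOnFintype (R := Λ) (M := fun _ => CanonicalModule R Λ))
    exact HasProjectiveDimensionLE.of_quotient_range hf (h _ hcoker)

/-- Over a nonsingular order `Λ` into which `R` splits, every maximal Cohen-Macaulay `R`-module is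
a direct summand of some `Λⁿ`. -/
theorem exists_retract_pi [IsLocalRing R] (hR : IsGorenstein R) (hdim : ringKrullDim R = 2)
    (hΛ : IsNonsingularOrder R Λ) (hs : StructureMapSplits R Λ) (M : Type u) [AddCommGroup M]
    [Module R M] (hM : IsMCM R M) :
    ∃ (n : ℕ) (i : M →ₗ[R] (Fin n → Λ)) (q : (Fin n → Λ) →ₗ[R] M), q ∘ₗ i = LinearMap.id := by
  obtain ⟨s, hs⟩ := hs
  have hs1 : s 1 = 1 := by simpa using LinearMap.congr_fun hs 1
  -- The depth of `R` is inherited from `Λ`, of which `R` is a direct summand.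
  have hreg : HasRegularPair R R :=
    (IsMCM.hasRegularPair hdim hΛ.isGorensteinOrder.isOrder).of_retract _ s hs
  have : Module.Finite R Λ := hΛ.isGorensteinOrder.isOrder.finite
  have : Module.Projective Λ (CanonicalModule R Λ) := hΛ.isGorensteinOrder.projective
  have : Module.Finite R M := hM.finite
  have : Module.Finite R (CoinducedModule R Λ M) := inferInstanceAs (Module.Finite R (Λ →ₗ[R] M))
  have hX : HasRegularPair R (CoinducedModule R Λ M) :=
    (IsMCM.hasRegularPair hdim hM).linearMap (Y := Λ)
  have : Module.Projective Λ (CoinducedModule R Λ M) :=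
    projective_of_extVanishes (fun Y _ _ _ n hn =>
      hreg.extVanishes hR hdim hreg.linearMap hn)
      hΛ.hasFiniteGlobalDimension _ fun n hn => hreg.extVanishes hR hdim hX hn
  have : Module.Finite Λ (CoinducedModule R Λ M) := .of_restrictScalars_finite R Λ _
  obtain ⟨n, p, hp⟩ := Module.Finite.exists_fin' Λ (CoinducedModule R Λ M)
  obtain ⟨σ, hσ⟩ := Module.projective_lifting_property p LinearMap.id hp
  let j : M →ₗ[R] CoinducedModule R Λ M := LinearMap.smulRightₗ s
  let e : CoinducedModule R Λ M →ₗ[R] M := LinearMap.applyₗ (R := R) (M₂ := M) (1 : Λ)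
  refine ⟨n, σ.restrictScalars R ∘ₗ j, e ∘ₗ p.restrictScalars R, ?_⟩
  ext m
  change e (p (σ (j m))) = m
  rw [show p (σ (j m)) = j m from LinearMap.congr_fun hσ (j m)]
  change s 1 • m = m
  rw [hs1, one_smul]

end Orders

/-! ### Compactness -/

section Compactness

theorem mem_objAnn_stableMCM_iff {R : Type u} [CommRing R] [IsLocalRing R] {M : StableMCM R}
    {r : R} : r ∈ objAnn R M ↔ r • LinearMap.id ∈ projMaps R M.module M.module := by
  rw [objAnn, Module.mem_annihilator]
  constructor
  · intro h
    exact (Submodule.Quotient.mk_eq_zero _).1 (h (𝟙 M))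
  · intro h f
    induction f using Submodule.Quotient.induction_on with | H f => ?_
    exact (Submodule.Quotient.mk_eq_zero _).2 (projMaps_comp_right h f)

/-- Through the coordinates of `Nⁿ`, `r • id` on `M` is a sum of maps that each factor through `r •
id` on `N`. -/
theorem smul_id_mem_projMaps_of_retract_pi {R : Type u} [CommRing R] {N M : Type u}
    [AddCommGroup N] [Module R N] [AddCommGroup M] [Module R M] {n : ℕ} (i : M →ₗ[R] (Fin n → N))
    (q : (Fin n → N) →ₗ[R] M) (hq : q ∘ₗ i = LinearMap.id) {r : R}
    (hr : r • LinearMap.id ∈ projMaps R N N) : r • LinearMap.id ∈ projMaps R M M := by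
  have : r • (LinearMap.id : M →ₗ[R] M) = ∑ k, (q ∘ₗ LinearMap.single R (fun _ => N) k) ∘ₗ
      (r • LinearMap.id) ∘ₗ LinearMap.proj k ∘ₗ i := by
    ext m
    simp only [LinearMap.sum_apply, LinearMap.comp_apply, LinearMap.smul_apply, LinearMap.id_apply,
      LinearMap.proj_apply, map_smul, ← Finset.smul_sum, ← map_sum, LinearMap.coe_single,
      Finset.univ_sum_single]
    rw [← LinearMap.comp_apply, hq, LinearMap.id_apply]
  rw [this]
  exact sum_mem fun k _ => projMaps_comp_left (projMaps_comp_right hr _) _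

theorem AlexandrovSpace.compactSpace_of_forall_le {R : Type w} [CommRing R] {C : Type u}
    [Category.{v} C] [Preadditive C] [Linear R C] (x : AlexandrovSpace R C) (hx : ∀ y, x ≤ y) :
    CompactSpace (AlexandrovSpace R C) := by
  have : Topology.IsUpperSet (AlexandrovSpace R C) := ⟨rfl⟩
  refine ⟨isCompact_of_finite_subcover fun U hU hcov => ?_⟩
  obtain ⟨i, hi⟩ := Set.mem_iUnion.1 (hcov (Set.mem_univ x))
  -- The single open set containing the least point already covers the space.
  refine ⟨{i}, fun y _ => ?_⟩
  simpa using Topology.IsUpperSet.isOpen_iff_isUpperSet.1 (hU i) (hx y) hi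

end Compactness

end CMSpace

theorem theorem4p3 (R : Type u) [CommRing R] [IsLocalRing R] (hR : CMSpace.IsGorenstein R)
    (hdim : ringKrullDim R = 2)
    (hΛ : ∃ (Λ : Type u) (_ : Ring Λ) (_ : Algebra R Λ),
      CMSpace.IsNonsingularOrder R Λ ∧ CMSpace.StructureMapSplits R Λ) :
    CompactSpace (CMSpace.CM R) := by
  obtain ⟨Λ, _, _, hΛ, hs⟩ := hΛ
  have := hR.isNoetherianRing
  let L : CMSpace.StableMCM R := ⟨ModuleCat.of R Λ, hΛ.isGorensteinOrder.isOrder⟩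
  refine CMSpace.AlexandrovSpace.compactSpace_of_forall_le
    (Quotient.mk (isIsomorphicSetoid _) L) fun y => ?_
  induction y using Quotient.inductionOn with | h M => ?_
  intro r hr
  obtain ⟨n, i, q, hq⟩ := CMSpace.exists_retract_pi hR hdim hΛ hs M.module M.isMCM
  exact CMSpace.mem_objAnn_stableMCM_iff.2
    (CMSpace.smul_id_mem_projMaps_of_retract_pi i q hq (CMSpace.mem_objAnn_stableMCM_iff.1 hr))
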